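/- \textbf{Setup.} Let $\ell^1$ be the space of real sequences $v=(v_0,v_1,\dots)$ with $\|v\|_1=\sum_k|v_k|<\infty$, and $\mathbb R^\infty\subset\ell^1$ the subspace of finitely supported sequences. For $x\in[-1,1]$ and $\Psi=(\psi_0,\dots,\psi_d)\in\mathbb R^{d+1}$ put $$U(x,\Psi)=e^{i\psi_0Z}\prod_{j=1}^d\bigl(W(x)e^{i\psi_jZ}\bigr),\qquad W(x)=\begin{pmatrix}x&i\sqrt{1-x^2}\\ i\sqrt{1-x^2}&x\end{pmatrix},\qquad Z=\begin{pmatrix}1&0\\0&-1\end{pmatrix}.$$ Fix a parity $p\in\{0,1\}$ (even or odd). To $\Phi=(\phi_0,\dots,\phi_m,0,0,\dots)\in\mathbb R^\infty$ (with $m$ the largest index of a nonzero entry, $m=0$ if $\Phi=0$) associate the symmetric phase factors $$\Psi=(\phi_m,\dots,\phi_1,2\phi_0,\phi_1,\dots,\phi_m)\ \ (p=0,\ d=2m),\qquad \Psi=(\phi_m,\dots,\phi_1,\phi_0,\phi_0,\phi_1,\dots,\phi_m)\ \ (p=1,\ d=2m+1),$$ and let $g(x,\Phi)$ be the imaginary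 part of the upper-left entry of $U(x,\Psi)$. Then there is $F(\Phi)=(c_0,c_1,\dots)\in\mathbb R^\infty$ with $g(x,\Phi)=\sum_j c_jT_{2j+p}(x)$ for all $x\in[-1,1]$, where $T_k$ are the Chebyshev polynomials of the first kind. Let $h(x)=2\cosh(2x)-2$ and $H(x)=\int_0^x(2-h(t))\,dt=4x-\sinh(2x)$; let $r_\Phi=h^{-1}(2)\approx0.658$ be the solution of $h(r_\Phi)=2$ in $[0,\infty)$, let $r_c=H(r_\Phi)\approx0.902$, and let $H^{-1}:[0,r_c]\to[0,r_\Phi]$ be the inverse of the increasing function $H|_{[0,r_\Phi]}$. \textbf{Theorem (Equivalence of distance in $\ell^1$).} For either parity, the following hold. The map $F:\mathbb R^\infty\to\mathbb R^\infty$ extends to a continuous map $\overline F:\ell^1\to\ell^1$. For every $c\in\ell^1$ with $\|c\|_1<r_c$ there is exactly one $\Phi\in\ell^1$ with $\|\Phi\|_1<r_\Phi$ and $\overline F(\Phi)=c$, denoted $\overline F^{-1}(c)$. If $c^{(1)},c^{(2)}\in\ell^1$ satisfy $\|c^{(j)}\|_1\le\theta<r_c$ and $\Phi^{(j)}:=\overline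 F^{-1}(c^{(j)})$ for $j=1,2$, then $$\widetilde C(\theta)\,\|\Phi^{(1)}-\Phi^{(2)}\|_1\le\|c^{(1)}-c^{(2)}\|_1\le C(\theta)\,\|\Phi^{(1)}-\Phi^{(2)}\|_1,$$ where $\widetilde C(\theta)=2-h(H^{-1}(\theta))>0$ and $C(\theta)=2\cosh(2H^{-1}(\theta))$. In particular $\overline F$ is bi-Lipschitz near the origin: there are $r,a,b>0$ with $a\|\Phi_1-\Phi_2\|_1\le\|\overline F(\Phi_1)-\overline F(\Phi_2)\|_1\le b\|\Phi_1-\Phi_2\|_1$ whenever $\|\Phi_1\|_1,\|\Phi_2\|_1<r$. -/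

import Mathlib

open scoped Topology

noncomputable section

namespace IQSP

/-- The two parities of target polynomials. -/
inductive Parity
  | even
  | odd

/-- The remainder modulo 2 that belongs to a parity. -/
def Parity.toNat : Parity → ℕ
  | .even => 0
  | .odd => 1

/-! ### The QSP unitary for a full set of phase factors -/

/-- `W(x) = exp(i arccos(x) X)` for `x ∈ [-1, 1]`. -/
def W (x : ℝ) : Matrix (Fin 2) (Fin 2) ℂ :=
  !![(x : ℂ), Complex.I * (Real.sqrt (1 - x ^ 2) : ℂ);
     Complex.I * (Real.sqrt (1 - x ^ 2) : ℂ), (x : ℂ)]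

/-- `exp(i ψ Z)` with `Z = diag(1, -1)`. -/
def expZ (ψ : ℝ) : Matrix (Fin 2) (Fin 2) ℂ :=
  !![Complex.exp (Complex.I * ψ), 0; 0, Complex.exp (-(Complex.I * ψ))]

/-- `U(x, Ψ) = exp(i ψ₀ Z) ∏_{j=1}^d (W(x) exp(i ψ_j Z))` for `Ψ = (ψ₀, …, ψ_d)`
(only the entries of index at most `d` are used). -/
def U (x : ℝ) (Ψ : ℕ → ℝ) : ℕ → Matrix (Fin 2) (Fin 2) ℂ
  | 0 => expZ (Ψ 0)
  | d + 1 => U x Ψ d * (W x * expZ (Ψ (d + 1)))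

/-! ### Reduced phase factors -/

/-- The degree `d` for which there are `m + 1` reduced phase factors `(φ₀, …, φ_m)`. -/
def fullDegree (p : Parity) (m : ℕ) : ℕ := 2 * m + p.toNat

/-- The symmetric full set `Ψ = (ψ₀, …, ψ_d)` of phase factors with reduced phase factors
`(φ₀, …, φ_m)`:
`(φ_m, …, φ₁, 2φ₀, φ₁, …, φ_m)` in the even case (`d = 2m`) and
`(φ_m, …, φ₁, φ₀, φ₀, φ₁, …, φ_m)` in the odd case (`d = 2m + 1`). -/
def fullPhases : Parity → ℕ → (ℕ → ℝ) → ℕ → ℝ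
  | .even, m, φ, j => if j < m then φ (m - j) else if j = m then 2 * φ 0 else φ (j - m)
  | .odd, m, φ, j => if j ≤ m then φ (m - j) else φ (j - (m + 1))

/-- The largest index of a nonzero entry of a finitely supported vector (`0` for the zero
vector). -/
def lastIndex (Φ : ℕ →₀ ℝ) : ℕ := Φ.support.sup id

/-- `g(x, Φ) = Im ⟨0|U(x, Φ)|0⟩` for reduced phase factors `Φ` in `ℝ^∞`, the space of finitely
supported real sequences. Trailing zeros of `Φ` are dropped. -/
def g (p : Parity) (x : ℝ) (Φ : ℕ →₀ ℝ) : ℝ :=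
  (U x (fullPhases p (lastIndex Φ) Φ) (fullDegree p (lastIndex Φ)) 0 0).im

/-! ### Chebyshev coefficients and the map `F` -/

/-- `∑_j c_j T_{2j}(x)` (even case) or `∑_j c_j T_{2j+1}(x)` (odd case). -/
def chebSum (p : Parity) (c : ℕ →₀ ℝ) (x : ℝ) : ℝ :=
  c.sum fun j a => a * (Polynomial.Chebyshev.T ℝ ((2 * j + p.toNat : ℕ) : ℤ)).eval x

open Classical in
/-- The Chebyshev-coefficient vector of a polynomial function on `[-1, 1]` of parity `p`. -/
def chebCoeffs (p : Parity) (f : ℝ → ℝ) : ℕ →₀ ℝ :=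
  if hf : ∃ c : ℕ →₀ ℝ, ∀ x ∈ Set.Icc (-1 : ℝ) 1, f x = chebSum p c x then hf.choose else 0

/-- The map `F : ℝ^∞ → ℝ^∞` that sends reduced phase factors `Φ` to the Chebyshev coefficients
of `g(·, Φ)`. -/
def F (p : Parity) (Φ : ℕ →₀ ℝ) : ℕ →₀ ℝ :=
  chebCoeffs p fun x => g p x Φ

/-! ### The extension to `ℓ¹` -/

/-- The Banach space `ℓ¹` of absolutely summable real sequences. -/
abbrev L1 : Type := lp (fun _ : ℕ => ℝ) 1

/-- The inclusion of `ℝ^∞` in `ℓ¹`. -/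
def toL1 (v : ℕ →₀ ℝ) : L1 :=
  ⟨fun n => v n, memℓp_gen (summable_of_ne_finset_zero (s := v.support) fun n hn => by
    simp [Finsupp.notMem_support_iff.mp hn])⟩

/-- The extension `F̄ : ℓ¹ → ℓ¹` of `F`: `F̄(Φ) = lim F(v)` as `v ∈ ℝ^∞` tends to `Φ` in the
1-norm. -/
def Fbar (p : Parity) (Φ : L1) : L1 :=
  Filter.limUnder (Filter.comap toL1 (𝓝 Φ)) fun v => toL1 (F p v)

/-! ### The constants -/

/-- `h(x) = 2 cosh(2x) - 2`. -/
def h (x : ℝ) : ℝ := 2 * Real.cosh (2 * x) - 2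

/-- `H(x) = ∫₀ˣ (2 - h(t)) dt = 4x - sinh(2x)`. -/
def H (x : ℝ) : ℝ := 4 * x - Real.sinh (2 * x)

/-- `r_Φ = h⁻¹(2)`, for the inverse of `h` on `[0, ∞)`. -/
def rPhi : ℝ := Function.invFunOn h (Set.Ici 0) 2

/-- `r_c = H(r_Φ)`. -/
def rC : ℝ := H rPhi

/-- `H⁻¹`, for the inverse of `H` on `[0, r_Φ]`, where `H` is increasing. -/
def HInv (θ : ℝ) : ℝ := Function.invFunOn H (Set.Icc 0 rPhi) θ

/-- `C₁(δ) = 2 cosh(2δ)`. -/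
def C₁ (δ : ℝ) : ℝ := 2 * Real.cosh (2 * δ)

/-- The constant of the lower bound, `2 - h(H⁻¹(θ))`. -/
def lowerConst (θ : ℝ) : ℝ := 2 - h (HInv θ)

/-- The constant of the upper bound, `C₁(H⁻¹(θ)) = 2 cosh(2 H⁻¹(θ))`. -/
def upperConst (θ : ℝ) : ℝ := C₁ (HInv θ)

/-- The inverse map `F̄⁻¹` on `{c : ‖c‖₁ < r_c}`: the solution `Φ` of `F̄(Φ) = c` with
`‖Φ‖₁ < r_Φ`. -/
def FbarInv (p : Parity) (c : L1) : L1 :=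
  Function.invFunOn (Fbar p) (Metric.ball 0 rPhi) c

theorem continuous_h : Continuous h := by unfold h; fun_prop

theorem continuous_H : Continuous H := by unfold H; fun_prop

/-- `r_Φ` is a point of `[0, ∞)` with `h(r_Φ) = 2`. -/
theorem rPhi_spec : 0 ≤ rPhi ∧ h rPhi = 2 := by
  have hex : ∃ x ∈ Set.Ici (0 : ℝ), h x = 2 := by
    have h0 : h 0 ≤ 2 := by simp [h]
    have h1 : 2 ≤ h 2 := by
      unfold h
      rw [Real.cosh_eq]
      norm_num
      have e1 := Real.add_one_le_exp (4 : ℝ)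
      have e2 := Real.exp_pos (-4 : ℝ)
      linarith
    obtain ⟨x, hx, hx2⟩ := intermediate_value_Icc (by norm_num : (0 : ℝ) ≤ 2)
      continuous_h.continuousOn ⟨h0, h1⟩
    exact ⟨x, hx.1, hx2⟩
  exact ⟨Function.invFunOn_mem hex, Function.invFunOn_eq hex⟩

/-- `H⁻¹(θ)` is a point of `[0, r_Φ]` with `H(H⁻¹(θ)) = θ`. -/
theorem HInv_spec {θ : ℝ} (h0 : 0 ≤ θ) (h1 : θ ≤ rC) :
    HInv θ ∈ Set.Icc 0 rPhi ∧ H (HInv θ) = θ := by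
  have hex : ∃ x ∈ Set.Icc (0 : ℝ) rPhi, H x = θ := by
    obtain ⟨x, hx, hx2⟩ := intermediate_value_Icc rPhi_spec.1
      continuous_H.continuousOn ⟨(by simpa [H] using h0 : H 0 ≤ θ), h1⟩
    exact ⟨x, hx, hx2⟩
  exact ⟨Function.invFunOn_mem hex, Function.invFunOn_eq hex⟩

end IQSP

end

/-!
Write `x = cos t`, so that `W(x) = exp(i t X)`. Since `X` and `Z` anticommute, every product of
phase factors has the form `∑ α_k exp(i (2k + d) t X) + ∑ β_k exp(i (2k + p) t X) i Z`, with finitely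
supported real sequences `α` and `β`. Here `d` is the number of factors `W`. The sequences `α` and
`β` collect the terms of even and of odd degree in the sines of the phase factors. Multiplication by
`exp(i ψ Z)` from either side acts on the pair by `α ↦ cos ψ α - sin ψ A β`,
`β ↦ cos ψ β + sin ψ B α`, where `A` and `B` only permute indices, and multiplication by `W(x)` on
both sides changes `d` alone (`U_fullPhases_eq_pairMat`). The symmetric product is built from the
centre outwards, so that trailing zeros of `Φ` have no effect. The imaginary part of the upper-left
entry is `∑ β_k cos((2k + p) t)`. Thus `F(Φ)` is the push-forward of `β` along
`k ↦ |2k + p| / 2` (`F_eq_coeffs`), which does not increase the `ℓ¹` norm.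

The recursion is majorized by the addition formulas for `cosh` and `sinh` (`Majorized.rot`). Along a
line `Φ + tΔ`, where the total size of the phase factors is `s = 2‖Φ + tΔ‖₁` and that of their
derivatives is `D = 2‖Δ‖₁`, the derivative of `β` differs from that of its linear term by at most
`D (cosh s - 1)`. As the linear term of `F` is `2Φ`, the nonlinear part `F(Φ) - 2Φ` has Lipschitz
constant `h R = 2 cosh(2R) - 2` on the ball of radius `R`, and its norm is at most
`sinh(2‖Φ‖₁) - 2‖Φ‖₁`.

Both estimates pass to the extension `F̄` by density (`norm_Fbar_sub_le`,
`norm_Fbar_sub_two_smul_le`). The first one gives the two-sided distance estimate with the constants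
`2 ± h R` and uniqueness on the ball of radius `r_Φ`. Existence is Banach's fixed point theorem for
`Φ ↦ (c - (F̄(Φ) - 2Φ)) / 2` on the ball of radius `R = H⁻¹(θ)`: the second estimate says that this
ball is mapped to itself, since `H R = 4R - sinh(2R) = θ`, and `h R < 2` makes the map a contraction
(`exists_Fbar_eq`).
-/

open scoped Topology

noncomputable section

namespace IQSP

/-! ### The `ℓ¹` norm on finitely supported sequences -/

section FinsuppNorm

variable {ι κ : Type*}

/-- The `ℓ¹` norm `∑ |v i|` of a finitely supported family. -/
instance finsuppNorm : Norm (ι →₀ ℝ) := ⟨fun v => v.sum fun _ a => |a|⟩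

theorem finsupp_norm_eq_sum (v : ι →₀ ℝ) {s : Finset ι} (hs : v.support ⊆ s) :
    ‖v‖ = ∑ i ∈ s, |v i| :=
  Finsupp.sum_of_support_subset v hs _ (by simp)

theorem finsuppNormCore : NormedSpace.Core ℝ (ι →₀ ℝ) where
  norm_nonneg v := Finset.sum_nonneg fun _ _ => abs_nonneg _
  norm_smul a v := by
    rw [finsupp_norm_eq_sum (a • v) Finsupp.support_smul, finsupp_norm_eq_sum v subset_rfl,
      Finset.mul_sum]
    simp [abs_mul]
  norm_triangle v w := by
    classical
    rw [finsupp_norm_eq_sum (v + w) Finsupp.support_add,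
      finsupp_norm_eq_sum v Finset.subset_union_left,
      finsupp_norm_eq_sum w Finset.subset_union_right, ← Finset.sum_add_distrib]
    exact Finset.sum_le_sum fun i _ => abs_add_le _ _
  norm_eq_zero_iff v := by
    rw [finsupp_norm_eq_sum v subset_rfl, Finset.sum_eq_zero_iff_of_nonneg fun _ _ => abs_nonneg _]
    refine ⟨fun hv => ?_, fun hv => by simp [hv]⟩
    ext i
    by_cases hi : i ∈ v.support
    · simpa using hv i hi
    · simpa using hi

instance finsuppNormedAddCommGroup : NormedAddCommGroup (ι →₀ ℝ) :=
  NormedAddCommGroup.ofCore finsuppNormCore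

instance finsuppNormedSpace : NormedSpace ℝ (ι →₀ ℝ) :=
  NormedSpace.ofCore finsuppNormCore

theorem norm_finsupp_single (i : ι) (a : ℝ) : ‖Finsupp.single i a‖ = |a| := by
  rw [finsupp_norm_eq_sum _ Finsupp.support_single_subset]
  simp

theorem norm_mapDomain_le (f : ι → κ) (v : ι →₀ ℝ) : ‖Finsupp.mapDomain f v‖ ≤ ‖v‖ := by
  refine (norm_sum_le _ _).trans (le_of_eq ?_)
  simp only [norm_finsupp_single]
  rfl

/-- The push-forward of finitely supported families along a map of the index sets, as a continuous
linear map for the `ℓ¹` norms. -/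
def push (f : ι → κ) : (ι →₀ ℝ) →L[ℝ] (κ →₀ ℝ) :=
  (Finsupp.lmapDomain ℝ ℝ f).mkContinuous 1 fun v => by
    simpa using norm_mapDomain_le f v

theorem push_apply (f : ι → κ) (v : ι →₀ ℝ) : push f v = Finsupp.mapDomain f v := rfl

theorem push_single (f : ι → κ) (i : ι) (a : ℝ) :
    push f (Finsupp.single i a) = Finsupp.single (f i) a := Finsupp.mapDomain_single

theorem norm_push_le (f : ι → κ) (v : ι →₀ ℝ) : ‖push f v‖ ≤ ‖v‖ := norm_mapDomain_le f v

end FinsuppNorm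

/-! ### Products of rotations and their majorants -/

theorem abs_sin_le_sinh_abs (x : ℝ) : |Real.sin x| ≤ Real.sinh |x| :=
  Real.abs_sin_le_abs.trans (Real.self_le_sinh_iff.2 (abs_nonneg x))

theorem abs_cos_sub_one_le (x : ℝ) : |Real.cos x - 1| ≤ Real.cosh |x| - 1 := by
  have h1 := Real.one_sub_sq_div_two_le_cos (x := x)
  have h2 : (Real.sinh (x / 2)) ^ 2 ≥ (x / 2) ^ 2 := by
    rw [ge_iff_le, sq_le_sq, Real.abs_sinh]
    exact Real.self_le_sinh_iff.2 (abs_nonneg _)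
  have h3 := Real.cosh_two_mul (x / 2)
  have h4 := Real.cosh_sq (x / 2)
  rw [mul_div_cancel₀ x two_ne_zero] at h3
  rw [Real.cosh_abs, abs_sub_comm, abs_of_nonneg (by linarith [Real.cos_le_one x])]
  nlinarith

section Rotation

variable {V : Type*} [NormedAddCommGroup V] [NormedSpace ℝ V]

/-- One factor of the product, `cos ψ + sin ψ · J`, acting on a pair (even part, odd part), where
`J` acts through `A` on odd parts, with a sign, and through `B` on even parts. -/
def rot (A B : V →L[ℝ] V) (ψ : ℝ) (q : V × V) : V × V :=
  (Real.cos ψ • q.1 - Real.sin ψ • A q.2, Real.cos ψ • q.2 + Real.sin ψ • B q.1)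

theorem rot_zero (A B : V →L[ℝ] V) (q : V × V) : rot A B 0 q = q := by simp [rot]

/-- The pair `q` of (even part, odd part) depends on a parameter and is at `t` majorized, with its
derivative `q'`, by that of the pair `(cosh s, sinh s)` with `s' = D`. The even part is compared
with its constant term `e`, and the derivative of the odd part with that of its linear term, `l`. -/
structure Majorized (e : V) (q : ℝ → V × V) (q' : V × V) (l : V) (t s D : ℝ) : Prop where
  hasDerivAt : HasDerivAt q q' t
  s_nonneg : 0 ≤ s
  D_nonneg : 0 ≤ D
  even_le : ‖(q t).1 - e‖ ≤ Real.cosh s - 1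
  odd_le : ‖(q t).2‖ ≤ Real.sinh s
  even_deriv_le : ‖q'.1‖ ≤ D * Real.sinh s
  linear_le : ‖l‖ ≤ D
  odd_deriv_le : ‖q'.2 - l‖ ≤ D * (Real.cosh s - 1)

/-- One rotation step preserves the majorization: `s` grows by `|ψ|` and `D` by `|ψ'|`, because
`|cos ψ|, |sin ψ|, |cos ψ - 1|` are at most `1, sinh |ψ|, cosh |ψ| - 1`, and the resulting bounds
recombine by the addition formulas. -/
theorem Majorized.rot {e l : V} {q : ℝ → V × V} {q' : V × V} {t s D : ℝ}
    (hq : Majorized e q q' l t s D) (he : ‖e‖ ≤ 1) {A B : V →L[ℝ] V}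
    (hA : ∀ v, ‖A v‖ ≤ ‖v‖) (hB : ∀ v, ‖B v‖ ≤ ‖v‖) {ψ : ℝ → ℝ} {δ : ℝ}
    (hψ : HasDerivAt ψ δ t) :
    ∃ r' : V × V, Majorized e (fun t => rot A B (ψ t) (q t)) r' (l + δ • B e) t
      (s + |ψ t|) (D + |δ|) := by
  obtain ⟨hd, hs, hD, hE, hO, hE', hl, hO'⟩ := hq
  have hd1 : HasDerivAt (fun t => (q t).1) q'.1 t := hd.fst
  have hd2 : HasDerivAt (fun t => (q t).2) q'.2 t := hd.snd
  have hA2 : HasDerivAt (fun t => A (q t).2) (A q'.2) t := A.hasFDerivAt.comp_hasDerivAt t hd2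
  have hB1 : HasDerivAt (fun t => B (q t).1) (B q'.1) t := B.hasFDerivAt.comp_hasDerivAt t hd1
  have hc := hψ.cos
  have hsn := hψ.sin
  refine ⟨_, ((hc.smul hd1).sub (hsn.smul hA2)).prodMk ((hc.smul hd2).add (hsn.smul hB1)),
    by positivity, by positivity, ?_, ?_, ?_, ?_, ?_⟩
  all_goals try dsimp only [IQSP.rot]
  all_goals
    generalize hq0 : q t = q0 at *
    obtain ⟨E, O⟩ := q0
    obtain ⟨E', O'⟩ := q'
    generalize ψ t = x at *
    simp only at hE hO hE' hO' ⊢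
    have b1 := abs_sin_le_sinh_abs x
    have b2 := abs_cos_sub_one_le x
    have b3 : |Real.cos x| ≤ 1 := Real.abs_cos_le_one x
    have hch : Real.cosh (s + |x|) =
      Real.cosh s * Real.cosh |x| + Real.sinh s * Real.sinh |x| := Real.cosh_add _ _
    have hsh : Real.sinh (s + |x|) =
      Real.sinh s * Real.cosh |x| + Real.cosh s * Real.sinh |x| := Real.sinh_add _ _
    have c1 := Real.one_le_cosh s
    have c2 := Real.one_le_cosh |x|
    have s1 := Real.sinh_nonneg_iff.2 hs
    have s2 := Real.sinh_nonneg_iff.2 (abs_nonneg x)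
    have hEn : ‖E‖ ≤ Real.cosh s := by
      have := norm_add_le (E - e) e
      rw [sub_add_cancel] at this
      linarith
    have hBE := (hB E).trans hEn
    have hAO := (hA O).trans hO
    have hBE' := (hB E').trans hE'
    have hOn' : ‖O'‖ ≤ D * Real.cosh s := by
      have := norm_add_le (O' - l) l
      rw [sub_add_cancel] at this
      linarith
    have hAO' := (hA O').trans hOn'
    generalize Real.cosh s = C at *
    generalize Real.sinh s = S at *
    generalize Real.cosh |x| = c at *
    generalize Real.sinh |x| = σ at *
  -- the even part
  · have : Real.cos x • E - Real.sin x • A O - e =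
        Real.cos x • (E - e) + (Real.cos x - 1) • e - Real.sin x • A O := by module
    rw [this, hch]
    calc _ ≤ ‖Real.cos x • (E - e)‖ + ‖(Real.cos x - 1) • e‖ + ‖Real.sin x • A O‖ :=
          (norm_sub_le _ _).trans (add_le_add (norm_add_le _ _) le_rfl)
      _ ≤ 1 * (C - 1) + (c - 1) * 1 + σ * S := by
          simp only [norm_smul, Real.norm_eq_abs]
          gcongr
      _ ≤ C * c + S * σ - 1 := by nlinarith
  -- the odd part
  · rw [hsh]
    calc _ ≤ ‖Real.cos x • O‖ + ‖Real.sin x • B E‖ := norm_add_le _ _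
      _ ≤ 1 * S + σ * C := by
          simp only [norm_smul, Real.norm_eq_abs]
          gcongr
      _ ≤ _ := by nlinarith
  -- the derivative of the even part
  · have : Real.cos x • E' + (-Real.sin x * δ) • E - (Real.sin x • A O' + (Real.cos x * δ) • A O) =
        Real.cos x • E' - Real.sin x • A O' - (δ • (Real.sin x • E) + δ • (Real.cos x • A O)) := by
      module
    rw [this, hsh]
    calc _ ≤ ‖Real.cos x • E'‖ + ‖Real.sin x • A O'‖ +
            (‖δ • (Real.sin x • E)‖ + ‖δ • (Real.cos x • A O)‖) :=
          (norm_sub_le _ _).trans (add_le_add (norm_sub_le _ _) (norm_add_le _ _))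
      _ ≤ 1 * (D * S) + σ * (D * C) + (|δ| * (σ * C) + |δ| * (1 * S)) := by
          simp only [norm_smul, Real.norm_eq_abs]
          gcongr
      _ = (D + |δ|) * (S + σ * C) := by ring
      _ ≤ (D + |δ|) * (S * c + C * σ) :=
          mul_le_mul_of_nonneg_left (by nlinarith) (by positivity)
  -- the linear term
  · refine (norm_add_le _ _).trans (add_le_add hl ?_)
    rw [norm_smul, Real.norm_eq_abs]
    exact mul_le_of_le_one_right (abs_nonneg δ) ((hB e).trans he)
  -- the derivative of the odd part
  · have : Real.cos x • O' + (-Real.sin x * δ) • O + (Real.sin x • B E' + (Real.cos x * δ) • B E) -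
        (l + δ • B e) = Real.cos x • (O' - l) + (Real.cos x - 1) • l + Real.sin x • B E' +
        δ • ((Real.cos x - 1) • B E + B (E - e) - Real.sin x • O) := by
      rw [map_sub]
      module
    rw [this, hch]
    calc _ ≤ ‖Real.cos x • (O' - l)‖ + ‖(Real.cos x - 1) • l‖ + ‖Real.sin x • B E'‖ +
            ‖δ • ((Real.cos x - 1) • B E + B (E - e) - Real.sin x • O)‖ := norm_add₄_le
      _ ≤ 1 * (D * (C - 1)) + (c - 1) * D + σ * (D * S) +
            |δ| * ((c - 1) * C + (C - 1) + σ * S) := by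
          have hBe := (hB (E - e)).trans hE
          have h3 : ‖(Real.cos x - 1) • B E + B (E - e) - Real.sin x • O‖ ≤
              (c - 1) * C + (C - 1) + σ * S := by
            refine (norm_sub_le _ _).trans (add_le_add ((norm_add_le _ _).trans
              (add_le_add ?_ hBe)) ?_)
            all_goals
              simp only [norm_smul, Real.norm_eq_abs]
              gcongr
          simp only [norm_smul, Real.norm_eq_abs]
          gcongr
      _ ≤ (D + |δ|) * (C * c + S * σ - 1) := by
          have : 0 ≤ D * ((C - 1) * (c - 1)) := by
            have := mul_nonneg (sub_nonneg.2 c1) (sub_nonneg.2 c2)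
            positivity
          nlinarith

end Rotation

/-! ### The product of a symmetric set of phase factors -/

/-- The matrix `exp(i n t X) = W(cos t) ^ n`. -/
def rotX (t : ℝ) (n : ℤ) : Matrix (Fin 2) (Fin 2) ℂ :=
  !![(Real.cos (n * t) : ℂ), Complex.I * (Real.sin (n * t) : ℂ);
     Complex.I * (Real.sin (n * t) : ℂ), (Real.cos (n * t) : ℂ)]

/-- The matrix `i Z`. -/
def matJ : Matrix (Fin 2) (Fin 2) ℂ := !![Complex.I, 0; 0, -Complex.I]

theorem rotX_zero (t : ℝ) : rotX t 0 = 1 := by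
  simp [rotX, Matrix.one_fin_two]

theorem rotX_mul_rotX (t : ℝ) (a b : ℤ) : rotX t a * rotX t b = rotX t (a + b) := by
  have h : ((a + b : ℤ) : ℝ) * t = a * t + b * t := by push_cast; ring
  simp only [rotX, h, Real.cos_add, Real.sin_add, Matrix.mul_fin_two]
  push_cast
  ext i j
  fin_cases i <;> fin_cases j <;> simp <;> ring_nf <;> simp <;> ring

theorem matJ_mul_rotX (t : ℝ) (n : ℤ) : matJ * rotX t n = rotX t (-n) * matJ := by
  ext i j
  fin_cases i <;> fin_cases j <;>
    simp [matJ, rotX, mul_comm]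

theorem matJ_mul_matJ : matJ * matJ = -1 := by
  ext i j
  fin_cases i <;> fin_cases j <;> simp [matJ]

theorem W_cos {t : ℝ} (ht : 0 ≤ Real.sin t) : W (Real.cos t) = rotX t 1 := by
  have : Real.sqrt (1 - Real.cos t ^ 2) = Real.sin t := by
    rw [← Real.sin_sq, Real.sqrt_sq ht]
  simp [W, rotX, this]

theorem expZ_eq (ψ : ℝ) : expZ ψ = Real.cos ψ • (1 : Matrix (Fin 2) (Fin 2) ℂ) +
    Real.sin ψ • matJ := by
  ext i j
  fin_cases i <;> fin_cases j
  · simp [expZ, matJ, mul_comm Complex.I, Complex.exp_mul_I]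
  · simp [expZ, matJ]
  · simp [expZ, matJ]
  · have : -(Complex.I * (ψ : ℂ)) = (-ψ : ℂ) * Complex.I := by ring
    simp [expZ, matJ, this, Complex.exp_mul_I, -neg_mul]
    simp

/-- The matrix `∑ α_k exp(i (2k + d) t X)`. -/
def evenMat (t : ℝ) (d : ℤ) : (ℤ →₀ ℝ) →ₗ[ℝ] Matrix (Fin 2) (Fin 2) ℂ :=
  Finsupp.linearCombination ℝ fun k => rotX t (2 * k + d)

/-- The matrix `∑ β_k exp(i (2k + p) t X) i Z`. -/
def oddMat (t : ℝ) (p : ℤ) : (ℤ →₀ ℝ) →ₗ[ℝ] Matrix (Fin 2) (Fin 2) ℂ :=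
  Finsupp.linearCombination ℝ fun k => rotX t (2 * k + p) * matJ

theorem evenMat_single (t : ℝ) (d k : ℤ) (a : ℝ) :
    evenMat t d (Finsupp.single k a) = a • rotX t (2 * k + d) := by
  simp [evenMat]

theorem oddMat_single (t : ℝ) (p k : ℤ) (a : ℝ) :
    oddMat t p (Finsupp.single k a) = a • (rotX t (2 * k + p) * matJ) := by
  simp [oddMat]

/-- The matrix that a pair (even part, odd part) of coefficient sequences stands for at
`x = cos t`. The odd part has exponents `2k + p`, which do not depend on the number `d` of factors
`W`, so that multiplication by `W` on both sides leaves the coefficients unchanged. -/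
def pairMat (t : ℝ) (d p : ℤ) (q : (ℤ →₀ ℝ) × (ℤ →₀ ℝ)) : Matrix (Fin 2) (Fin 2) ℂ :=
  evenMat t d q.1 + oddMat t p q.2

theorem linear_eq_of_single {M : Type*} [AddCommGroup M] [Module ℝ M]
    {f g : (ℤ →₀ ℝ) →ₗ[ℝ] M} (h : ∀ k, f (Finsupp.single k 1) = g (Finsupp.single k 1))
    (v : ℤ →₀ ℝ) : f v = g v :=
  DFunLike.congr_fun (Finsupp.lhom_ext' fun k => LinearMap.ext_ring (h k)) v

/-- Multiplication by `exp(i ψ Z)` from the left is one rotation step on the coefficients. -/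
theorem expZ_mul_pairMat (t ψ : ℝ) (p m : ℤ) (q : (ℤ →₀ ℝ) × (ℤ →₀ ℝ)) :
    expZ ψ * pairMat t (2 * m + p) p q = pairMat t (2 * m + p) p
      (rot (push fun k => -k - (m + p)) (push fun k => -k - (m + p)) ψ q) := by
  have h1 : matJ * evenMat t (2 * m + p) q.1 = oddMat t p (push (fun k => -k - (m + p)) q.1) := by
    refine linear_eq_of_single (f := (LinearMap.mulLeft ℝ matJ).comp (evenMat t (2 * m + p)))
      (g := (oddMat t p).comp (push fun k => -k - (m + p)).toLinearMap) (fun k => ?_) q.1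
    simp only [LinearMap.comp_apply, LinearMap.mulLeft_apply, ContinuousLinearMap.coe_coe,
      push_single, evenMat_single, oddMat_single, one_smul, matJ_mul_rotX]
    congr 2; ring
  have h2 : matJ * oddMat t p q.2 =
      -evenMat t (2 * m + p) (push (fun k => -k - (m + p)) q.2) := by
    refine linear_eq_of_single (f := (LinearMap.mulLeft ℝ matJ).comp (oddMat t p))
      (g := -(evenMat t (2 * m + p)).comp (push fun k => -k - (m + p)).toLinearMap)
      (fun k => ?_) q.2
    simp only [LinearMap.comp_apply, LinearMap.mulLeft_apply, ContinuousLinearMap.coe_coe,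
      LinearMap.neg_apply, push_single, evenMat_single, oddMat_single, one_smul]
    rw [← mul_assoc, matJ_mul_rotX, mul_assoc, matJ_mul_matJ, mul_neg_one]
    congr 2; ring
  simp only [pairMat, rot, map_add, map_sub, map_smul, expZ_eq, add_mul, smul_mul_assoc, one_mul,
    mul_add, h1, h2]
  module

/-- Multiplication by `exp(i ψ Z)` from the right is one rotation step on the coefficients. -/
theorem pairMat_mul_expZ (t ψ : ℝ) (p m : ℤ) (q : (ℤ →₀ ℝ) × (ℤ →₀ ℝ)) :
    pairMat t (2 * m + p) p q * expZ ψ = pairMat t (2 * m + p) p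
      (rot (push fun k => k - m) (push fun k => k + m) ψ q) := by
  have h1 : evenMat t (2 * m + p) q.1 * matJ = oddMat t p (push (fun k => k + m) q.1) := by
    refine linear_eq_of_single (f := (LinearMap.mulRight ℝ matJ).comp (evenMat t (2 * m + p)))
      (g := (oddMat t p).comp (push fun k => k + m).toLinearMap) (fun k => ?_) q.1
    simp only [LinearMap.comp_apply, LinearMap.mulRight_apply, ContinuousLinearMap.coe_coe,
      push_single, evenMat_single, oddMat_single, one_smul]
    congr 2; ring
  have h2 : oddMat t p q.2 * matJ = -evenMat t (2 * m + p) (push (fun k => k - m) q.2) := by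
    refine linear_eq_of_single (f := (LinearMap.mulRight ℝ matJ).comp (oddMat t p))
      (g := -(evenMat t (2 * m + p)).comp (push fun k => k - m).toLinearMap)
      (fun k => ?_) q.2
    simp only [LinearMap.comp_apply, LinearMap.mulRight_apply, ContinuousLinearMap.coe_coe,
      LinearMap.neg_apply, push_single, evenMat_single, oddMat_single, one_smul]
    rw [mul_assoc, matJ_mul_matJ, mul_neg_one]
    congr 2; ring
  simp only [pairMat, rot, map_add, map_sub, map_smul, expZ_eq, mul_add, mul_smul_comm, mul_one,
    add_mul, h1, h2]
  module

theorem rotX_mul_pairMat_mul_rotX (t : ℝ) (d p : ℤ) (q : (ℤ →₀ ℝ) × (ℤ →₀ ℝ)) :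
    rotX t 1 * pairMat t d p q * rotX t 1 = pairMat t (d + 2) p q := by
  have h1 : rotX t 1 * evenMat t d q.1 * rotX t 1 = evenMat t (d + 2) q.1 := by
    refine linear_eq_of_single (f := (LinearMap.mulRight ℝ (rotX t 1)).comp
      ((LinearMap.mulLeft ℝ (rotX t 1)).comp (evenMat t d))) (fun k => ?_) q.1
    simp only [LinearMap.comp_apply, LinearMap.mulRight_apply, LinearMap.mulLeft_apply,
      evenMat_single, one_smul, rotX_mul_rotX]
    congr 1; ring
  have h2 : rotX t 1 * oddMat t p q.2 * rotX t 1 = oddMat t p q.2 := by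
    refine linear_eq_of_single (f := (LinearMap.mulRight ℝ (rotX t 1)).comp
      ((LinearMap.mulLeft ℝ (rotX t 1)).comp (oddMat t p))) (fun k => ?_) q.2
    simp only [LinearMap.comp_apply, LinearMap.mulRight_apply, LinearMap.mulLeft_apply,
      oddMat_single, one_smul]
    rw [mul_assoc, mul_assoc, matJ_mul_rotX, ← mul_assoc, ← mul_assoc, rotX_mul_rotX,
      rotX_mul_rotX]
    congr 2; ring
  rw [pairMat, mul_add, add_mul, h1, h2, pairMat]

/-- The coefficient pair of the product of the phase factors `φ₀, …, φ_{m-1}`, which are placed on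
both sides from the centre outwards. A vanishing phase factor leaves the pair unchanged, so that
the pair does not see how many zeros follow the nonzero entries of `φ`. -/
def coeffPair (p : Parity) (φ : ℕ → ℝ) : ℕ → (ℤ →₀ ℝ) × (ℤ →₀ ℝ)
  | 0 => (Finsupp.single 0 1, 0)
  | m + 1 =>
    rot (push fun k => k - (m : ℤ)) (push fun k => k + (m : ℤ)) (φ m)
      (rot (push fun k => -k - ((m : ℤ) + p.toNat)) (push fun k => -k - ((m : ℤ) + p.toNat)) (φ m)
        (coeffPair p φ m))

theorem U_congr (x : ℝ) {Ψ Ψ' : ℕ → ℝ} (d : ℕ) (h : ∀ j ≤ d, Ψ j = Ψ' j) :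
    U x Ψ d = U x Ψ' d := by
  induction d with
  | zero => simp [U, h 0 le_rfl]
  | succ d ih => rw [U, U, ih fun j hj => h j (by omega), h (d + 1) le_rfl]

theorem U_succ_left (x : ℝ) (Ψ : ℕ → ℝ) (d : ℕ) :
    U x Ψ (d + 1) = expZ (Ψ 0) * W x * U x (fun j => Ψ (j + 1)) d := by
  induction d with
  | zero => simp [U, mul_assoc]
  | succ d ih => rw [U, ih, U]; simp only [mul_assoc]

theorem expZ_add (a b : ℝ) : expZ (a + b) = expZ a * expZ b := by
  ext i j
  fin_cases i <;> fin_cases j <;>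
    simp [expZ, mul_add, Complex.exp_add, mul_comm]

/-- The full set of phase factors for `m + 1` is that for `m` with `φ (m + 1)` added at both ends.
-/
theorem U_fullPhases_succ (p : Parity) (x : ℝ) (φ : ℕ → ℝ) (m : ℕ) :
    U x (fullPhases p (m + 1) φ) (fullDegree p (m + 1)) =
      expZ (φ (m + 1)) * (W x * U x (fullPhases p m φ) (fullDegree p m) * W x) *
        expZ (φ (m + 1)) := by
  have hd : fullDegree p (m + 1) = fullDegree p m + 1 + 1 := by simp [fullDegree]; ring
  have h0 : fullPhases p (m + 1) φ 0 = φ (m + 1) := by cases p <;> simp [fullPhases]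
  have h1 : fullPhases p (m + 1) φ (fullDegree p m + 1 + 1) = φ (m + 1) := by
    cases p
    · have hm : fullDegree Parity.even m = 2 * m := by simp [fullDegree, Parity.toNat]
      rw [hm, fullPhases, if_neg (by omega), if_neg (by omega)]
      congr 1; omega
    · have hm : fullDegree Parity.odd m = 2 * m + 1 := by simp [fullDegree, Parity.toNat]
      rw [hm, fullPhases, if_neg (by omega)]
      congr 1; omega
  have h2 : U x (fun j => fullPhases p (m + 1) φ (j + 1)) (fullDegree p m) =
      U x (fullPhases p m φ) (fullDegree p m) := by
    refine U_congr x _ fun j hj => ?_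
    cases p
    · simp only [fullPhases]
      split_ifs <;> first | omega | rfl | (congr 1; omega)
    · simp only [fullPhases]
      split_ifs <;> first | omega | rfl | (congr 1; omega)
  rw [hd, U, U_succ_left, h0, h1, h2]
  simp only [mul_assoc]

theorem U_fullPhases_eq_pairMat (p : Parity) {t : ℝ} (ht : 0 ≤ Real.sin t) (φ : ℕ → ℝ) (m : ℕ) :
    U (Real.cos t) (fullPhases p m φ) (fullDegree p m) =
      pairMat t (2 * (m : ℤ) + p.toNat) p.toNat (coeffPair p φ (m + 1)) := by
  induction m with
  | zero =>
    have h0 : U (Real.cos t) (fullPhases p 0 φ) (fullDegree p 0) =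
        expZ (φ 0) * rotX t p.toNat * expZ (φ 0) := by
      cases p
      · simp [fullDegree, Parity.toNat, U, fullPhases, rotX_zero, two_mul, expZ_add]
      · simp [fullDegree, Parity.toNat, U, fullPhases, W_cos ht, mul_assoc]
    have h1 : rotX t p.toNat = pairMat t (2 * ((0 : ℕ) : ℤ) + p.toNat) p.toNat
        (coeffPair p φ 0) := by
      simp [pairMat, coeffPair, evenMat_single]
    rw [h0, h1, expZ_mul_pairMat, pairMat_mul_expZ, ← coeffPair]
  | succ m ih =>
    have h1 : (2 * (m : ℤ) + p.toNat) + 2 = 2 * ((m + 1 : ℕ) : ℤ) + p.toNat := by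
      push_cast; ring
    rw [U_fullPhases_succ, ih, W_cos ht, rotX_mul_pairMat_mul_rotX, h1, expZ_mul_pairMat,
      pairMat_mul_expZ, ← coeffPair]

theorem coeffPair_eq_of_le (p : Parity) (φ : ℕ → ℝ) {m n : ℕ} (hmn : m ≤ n)
    (h : ∀ k, m ≤ k → φ k = 0) : coeffPair p φ n = coeffPair p φ m := by
  induction n, hmn using Nat.le_induction with
  | base => rfl
  | succ n hmn ih => rw [coeffPair, h n hmn, rot_zero, rot_zero, ih]

/-! ### Chebyshev coefficients -/

/-- The index `j` of the Chebyshev polynomial `T_{2j + p}` that `cos ((2k + p) t)` is. -/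
def foldIndex (p : Parity) (k : ℤ) : ℕ := (2 * k + p.toNat).natAbs / 2

theorem two_mul_foldIndex (p : Parity) (k : ℤ) :
    2 * foldIndex p k + p.toNat = (2 * k + p.toNat).natAbs := by
  cases p <;> simp only [foldIndex, Parity.toNat] <;> omega

theorem foldIndex_natCast (p : Parity) (m : ℕ) : foldIndex p m = m := by
  cases p <;> simp only [foldIndex, Parity.toNat] <;> omega

theorem foldIndex_reflect (p : Parity) (m : ℕ) : foldIndex p (-((m : ℤ) + p.toNat)) = m := by
  cases p <;> simp only [foldIndex, Parity.toNat] <;> omega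

/-- The Chebyshev coefficients of `g(·, Φ)`, read off from the odd part of the product. -/
def coeffs (p : Parity) (Φ : ℕ →₀ ℝ) : ℕ →₀ ℝ :=
  push (foldIndex p) (coeffPair p Φ (lastIndex Φ + 1)).2

theorem apply_eq_zero_of_lastIndex_lt {Φ : ℕ →₀ ℝ} {k : ℕ} (h : lastIndex Φ < k) : Φ k = 0 := by
  by_contra hk
  exact absurd (Finset.le_sup (f := id) (Finsupp.mem_support_iff.2 hk)) (not_le.2 h)

theorem coeffs_eq_of_forall_le (p : Parity) {Φ : ℕ →₀ ℝ} {n : ℕ} (h : ∀ k, n ≤ k → Φ k = 0) :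
    coeffs p Φ = push (foldIndex p) (coeffPair p Φ n).2 := by
  rw [coeffs, ← coeffPair_eq_of_le p Φ (le_max_left (lastIndex Φ + 1) n)
    fun k hk => apply_eq_zero_of_lastIndex_lt hk, coeffPair_eq_of_le p Φ (le_max_right _ n) h]

theorem chebSum_push_cos (p : Parity) (t : ℝ) (β : ℤ →₀ ℝ) :
    chebSum p (push (foldIndex p) β) (Real.cos t) =
      β.sum fun k b => b * Real.cos ((2 * k + p.toNat : ℤ) * t) := by
  rw [chebSum, push_apply, Finsupp.sum_mapDomain_index (by simp) (by intros; ring)]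
  refine Finsupp.sum_congr fun k _ => ?_
  rw [two_mul_foldIndex, Polynomial.Chebyshev.T_natAbs, Polynomial.Chebyshev.T_real_cos]

theorem g_eq_chebSum (p : Parity) (Φ : ℕ →₀ ℝ) {x : ℝ} (hx : x ∈ Set.Icc (-1 : ℝ) 1) :
    g p x Φ = chebSum p (coeffs p Φ) x := by
  obtain ⟨t, ht, rfl⟩ : ∃ t, 0 ≤ Real.sin t ∧ Real.cos t = x :=
    ⟨Real.arccos x, by rw [Real.sin_arccos]; positivity, Real.cos_arccos hx.1 hx.2⟩
  rw [g, U_fullPhases_eq_pairMat p ht, coeffs, chebSum_push_cos, pairMat]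
  simp only [evenMat, oddMat, Finsupp.linearCombination_apply, Finsupp.sum, Matrix.add_apply,
    Matrix.sum_apply, Complex.add_im, Complex.im_sum]
  -- the upper-left entries of the even part are real
  rw [Finset.sum_eq_zero, zero_add]
  · refine Finset.sum_congr rfl fun k _ => ?_
    simp [rotX, matJ, -Complex.ofReal_cos]
  · intro k _
    simp [rotX, -Complex.ofReal_cos]

/-- A finite Chebyshev expansion is determined by its values on `[-1, 1]`, because the polynomials
`T_n` are linearly independent. -/
theorem chebSum_injOn (p : Parity) {c c' : ℕ →₀ ℝ}
    (h : ∀ x ∈ Set.Icc (-1 : ℝ) 1, chebSum p c x = chebSum p c' x) : c = c' := by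
  let P : ℕ → Polynomial ℝ := fun j => Polynomial.Chebyshev.T ℝ ((2 * j + p.toNat : ℕ) : ℤ)
  have hP : LinearIndependent ℝ P := by
    have h1 := (Polynomial.Chebyshev.chebyshevTsequence ℝ).linearIndependent
    exact h1.comp (fun j => 2 * j + p.toNat) fun i j hij => by simpa using hij
  have hev : ∀ (c : ℕ →₀ ℝ) x, (Finsupp.linearCombination ℝ P c).eval x = chebSum p c x := by
    intro c x
    simp [Finsupp.linearCombination_apply, Finsupp.sum, chebSum, Polynomial.eval_finsetSum, P]
  refine hP (Polynomial.eq_of_infinite_eval_eq _ _ ((Set.Icc_infinite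
    (by norm_num : (-1 : ℝ) < 1)).mono fun x hx => ?_))
  simpa [hev] using h x hx

theorem F_eq_coeffs (p : Parity) (Φ : ℕ →₀ ℝ) : F p Φ = coeffs p Φ := by
  have hf : ∃ c : ℕ →₀ ℝ, ∀ x ∈ Set.Icc (-1 : ℝ) 1, g p x Φ = chebSum p c x :=
    ⟨coeffs p Φ, fun x hx => g_eq_chebSum p Φ hx⟩
  rw [F, chebCoeffs, dif_pos hf]
  exact chebSum_injOn p fun x hx => by rw [← hf.choose_spec x hx, g_eq_chebSum p Φ hx]

/-! ### The nonlinear part of `F` on finitely supported sequences -/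

theorem h_nonneg (x : ℝ) : 0 ≤ h x := by
  have := Real.one_le_cosh (2 * x)
  unfold h; linarith

theorem h_le_h {x y : ℝ} (hx : 0 ≤ x) (hxy : x ≤ y) : h x ≤ h y := by
  have : Real.cosh (2 * x) ≤ Real.cosh (2 * y) := by
    rw [Real.cosh_le_cosh, abs_of_nonneg (by linarith), abs_of_nonneg (by linarith)]
    linarith
  unfold h; linarith

theorem h_lt_h {x y : ℝ} (hx : 0 ≤ x) (hxy : x < y) : h x < h y := by
  have : Real.cosh (2 * x) < Real.cosh (2 * y) := by
    rw [Real.cosh_lt_cosh, abs_of_nonneg (by linarith), abs_of_nonneg (by linarith)]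
    linarith
  unfold h; linarith

/-- The majorant of the product along a curve of phase factors. Each of the phase factors occurs
twice. -/
theorem exists_majorized_coeffPair (p : Parity) {φ : ℝ → ℕ → ℝ} {δ : ℕ → ℝ} {t : ℝ}
    (hφ : ∀ k, HasDerivAt (fun t => φ t k) (δ k) t) (n : ℕ) :
    ∃ q', Majorized (Finsupp.single 0 1) (fun t => coeffPair p (φ t) n) q'
      (∑ k ∈ Finset.range n, δ k •
        (Finsupp.single (-((k : ℤ) + p.toNat)) 1 + Finsupp.single (k : ℤ) 1)) t
      (2 * ∑ k ∈ Finset.range n, |φ t k|) (2 * ∑ k ∈ Finset.range n, |δ k|) := by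
  induction n with
  | zero =>
    refine ⟨0, ?_, ?_, ?_, ?_, ?_, ?_, ?_, ?_⟩
    · exact hasDerivAt_const _ _
    all_goals simp [coeffPair]
  | succ n ih =>
    obtain ⟨q', hq⟩ := ih
    have he : ‖(Finsupp.single 0 1 : ℤ →₀ ℝ)‖ ≤ 1 := by simp [norm_finsupp_single]
    obtain ⟨r', hr⟩ := hq.rot he (A := push fun k => -k - ((n : ℤ) + p.toNat))
      (B := push fun k => -k - ((n : ℤ) + p.toNat)) (norm_push_le _) (norm_push_le _) (hφ n)
    obtain ⟨w', hw⟩ := hr.rot he (A := push fun k => k - (n : ℤ))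
      (B := push fun k => k + (n : ℤ)) (norm_push_le _) (norm_push_le _) (hφ n)
    refine ⟨w', ?_⟩
    convert! hw using 1
    · rw [Finset.sum_range_succ, smul_add, add_assoc, push_single, push_single, neg_zero, zero_sub,
        zero_add]
    · rw [Finset.sum_range_succ]; ring
    · rw [Finset.sum_range_succ]; ring

/-- The nonlinear part `F(Φ) - 2 Φ`. -/
def residual (p : Parity) (Φ : ℕ →₀ ℝ) : ℕ →₀ ℝ := coeffs p Φ - (2 : ℝ) • Φ

/-- The derivative of the nonlinear part along a line, by the majorant with `s = 2 ‖Φ + t Δ‖` and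
`D = 2 ‖Δ‖`. -/
theorem exists_hasDerivAt_residual (p : Parity) (Φ Δ : ℕ →₀ ℝ) (t : ℝ) :
    ∃ d, HasDerivAt (fun t : ℝ => residual p (Φ + t • Δ)) d t ∧
      ‖d‖ ≤ h ‖Φ + t • Δ‖ * ‖Δ‖ := by
  obtain ⟨n, hn⟩ : ∃ n, ∀ k, n ≤ k → Φ k = 0 ∧ Δ k = 0 :=
    ⟨max (lastIndex Φ) (lastIndex Δ) + 1, fun k hk =>
      ⟨apply_eq_zero_of_lastIndex_lt (by omega), apply_eq_zero_of_lastIndex_lt (by omega)⟩⟩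
  have hv : ∀ t : ℝ, ∀ k, n ≤ k → (Φ + t • Δ) k = 0 := fun t k hk => by simp [hn k hk]
  have hsupp : ∀ {v : ℕ →₀ ℝ}, (∀ k, n ≤ k → v k = 0) → v.support ⊆ Finset.range n := by
    intro v hv k hk
    rw [Finset.mem_range]
    by_contra hkn
    exact Finsupp.mem_support_iff.1 hk (hv k (not_lt.1 hkn))
  have hφ : ∀ k, HasDerivAt (fun t : ℝ => (Φ + t • Δ) k) (Δ k) t := fun k => by
    simpa using ((hasDerivAt_id t).mul_const (Δ k)).const_add (Φ k)
  obtain ⟨q', hq⟩ := exists_majorized_coeffPair p hφ n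
  rw [← finsupp_norm_eq_sum _ (hsupp (hv t)),
    ← finsupp_norm_eq_sum Δ (hsupp fun k hk => (hn k hk).2)] at hq
  set l : ℤ →₀ ℝ := ∑ k ∈ Finset.range n, Δ k •
        (Finsupp.single (-((k : ℤ) + p.toNat)) 1 + Finsupp.single (k : ℤ) 1) with hl
  -- the two linear terms of each phase factor fold onto the same Chebyshev polynomial
  have hl2 : push (foldIndex p) l = (2 : ℝ) • Δ := by
    have : ∑ k ∈ Finset.range n, Finsupp.single k (Δ k) = Δ := by
      rw [← Finsupp.sum_of_support_subset Δ (hsupp fun k hk => (hn k hk).2) Finsupp.single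
        (by simp), Finsupp.sum_single]
    rw [hl, map_sum]
    nth_rw 2 [← this]
    rw [Finset.smul_sum]
    refine Finset.sum_congr rfl fun k _ => ?_
    rw [map_smul, map_add, push_single, push_single, foldIndex_natCast, foldIndex_reflect,
      ← two_smul ℝ, smul_smul, Finsupp.smul_single, Finsupp.smul_single]
    simp [mul_comm]
  refine ⟨push (foldIndex p) (q'.2 - l), ?_, ?_⟩
  · have h1 : HasDerivAt (fun t => push (foldIndex p) (coeffPair p (Φ + t • Δ : ℕ →₀ ℝ) n).2)
        (push (foldIndex p) q'.2) t :=
      (push (foldIndex p)).hasFDerivAt.comp_hasDerivAt t hq.hasDerivAt.snd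
    have h2 : HasDerivAt (fun t : ℝ => (2 : ℝ) • (Φ + t • Δ)) ((2 : ℝ) • Δ) t := by
      have h3 := (((hasDerivAt_id t).smul_const Δ).const_add Φ).const_smul (2 : ℝ)
      rw [one_smul] at h3
      exact h3
    rw [map_sub, hl2]
    refine (h1.sub h2).congr_of_eventuallyEq (Filter.Eventually.of_forall fun t => ?_)
    simp only [residual, coeffs_eq_of_forall_le p (hv t), Pi.sub_apply]
  · refine (norm_push_le _ _).trans (hq.odd_deriv_le.trans (le_of_eq ?_))
    unfold h; ring

/-- The mean value inequality on the segment from `Φ` to `Φ'`, which stays in the ball. -/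
theorem norm_residual_sub_le (p : Parity) {Φ Φ' : ℕ →₀ ℝ} {R : ℝ} (hΦ : ‖Φ‖ ≤ R)
    (hΦ' : ‖Φ'‖ ≤ R) : ‖residual p Φ' - residual p Φ‖ ≤ h R * ‖Φ' - Φ‖ := by
  choose d hd hd2 using exists_hasDerivAt_residual p Φ (Φ' - Φ)
  have := norm_image_sub_le_of_norm_deriv_le_segment_01'
    (f := fun t : ℝ => residual p (Φ + t • (Φ' - Φ))) (C := h R * ‖Φ' - Φ‖)
    (fun t _ => (hd t).hasDerivWithinAt) fun t ht => (hd2 t).trans ?_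
  · simpa using this
  · refine mul_le_mul_of_nonneg_right (h_le_h (norm_nonneg _) ?_) (norm_nonneg _)
    have : Φ + t • (Φ' - Φ) = (1 - t) • Φ + t • Φ' := by module
    rw [this]
    refine (norm_add_le _ _).trans ?_
    rw [norm_smul, norm_smul, Real.norm_of_nonneg ht.1, Real.norm_of_nonneg (by linarith [ht.2])]
    nlinarith [ht.1, ht.2]

theorem residual_zero (p : Parity) : residual p 0 = 0 := by
  rw [residual, coeffs_eq_of_forall_le p (n := 0) (by simp)]
  simp [coeffPair]

/-- The derivative bound `h (t ‖Φ‖) ‖Φ‖` along the ray `t Φ`, integrated over `[0, 1]`. -/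
theorem norm_residual_le (p : Parity) (Φ : ℕ →₀ ℝ) :
    ‖residual p Φ‖ ≤ Real.sinh (2 * ‖Φ‖) - 2 * ‖Φ‖ := by
  choose d hd hd2 using exists_hasDerivAt_residual p 0 Φ
  have hB : ∀ t : ℝ, HasDerivAt (fun t => Real.sinh (2 * ‖Φ‖ * t) - 2 * ‖Φ‖ * t)
      (Real.cosh (2 * ‖Φ‖ * t) * (2 * ‖Φ‖) - 2 * ‖Φ‖) t := fun t => by
    have h1 : HasDerivAt (fun t => 2 * ‖Φ‖ * t) (2 * ‖Φ‖) t := by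
      simpa using (hasDerivAt_id t).const_mul (2 * ‖Φ‖)
    exact h1.sinh.sub h1
  have := image_norm_le_of_norm_deriv_right_le_deriv_boundary (a := 0) (b := 1)
    (f := fun t : ℝ => residual p (0 + t • Φ))
    (fun t _ => (hd t).continuousAt.continuousWithinAt) (fun t _ => (hd t).hasDerivWithinAt)
    (by simp [residual_zero]) hB (fun t ht => (hd2 t).trans (le_of_eq ?_))
    (Set.right_mem_Icc.2 zero_le_one)
  · simpa using this
  · rw [zero_add, norm_smul, Real.norm_of_nonneg ht.1, h, show 2 * (t * ‖Φ‖) = 2 * ‖Φ‖ * t by ring]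
    ring

/-! ### The extension to `ℓ¹` -/

theorem norm_toL1 (v : ℕ →₀ ℝ) : ‖toL1 v‖ = ‖v‖ := by
  rw [lp.norm_eq_tsum_rpow (by simp)]
  simp only [ENNReal.toReal_one, Real.rpow_one, div_one]
  rw [tsum_eq_sum (s := v.support) fun k hk => by
    simpa [toL1] using Finsupp.notMem_support_iff.1 hk]
  rfl

theorem toL1_sub (v w : ℕ →₀ ℝ) : toL1 (v - w) = toL1 v - toL1 w := by
  ext n
  exact Finsupp.sub_apply v w n

theorem toL1_smul (a : ℝ) (v : ℕ →₀ ℝ) : toL1 (a • v) = a • toL1 v := by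
  ext n
  simp [toL1]

theorem denseRange_toL1 : DenseRange toL1 := fun Φ => by
  refine mem_closure_of_tendsto (lp.hasSum_single ENNReal.one_ne_top Φ)
    (Filter.Eventually.of_forall fun s => ⟨∑ i ∈ s, Finsupp.single i (Φ i), ?_⟩)
  ext n
  simp only [toL1, lp.coeFn_sum, Finset.sum_apply, Finsupp.finsetSum_apply]
  refine Finset.sum_congr rfl fun i _ => ?_
  rw [lp.single_apply, Finsupp.single_apply]
  by_cases hin : i = n
  · subst hin; simp
  · simp [hin, Ne.symm hin]

instance comap_toL1_neBot (Φ : L1) : (Filter.comap toL1 (𝓝 Φ)).NeBot :=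
  Filter.comap_neBot_iff_frequently.2 (mem_closure_iff_frequently.1 (denseRange_toL1 Φ))

theorem toL1_F_sub_eq (p : Parity) (v : ℕ →₀ ℝ) :
    toL1 (F p v) - (2 : ℝ) • toL1 v = toL1 (residual p v) := by
  rw [F_eq_coeffs, residual, toL1_sub, toL1_smul]

theorem norm_toL1_F_sub_le (p : Parity) (v w : ℕ →₀ ℝ) :
    ‖(toL1 (F p v) - (2 : ℝ) • toL1 v) - (toL1 (F p w) - (2 : ℝ) • toL1 w)‖ ≤
      h (max ‖toL1 v‖ ‖toL1 w‖) * ‖toL1 v - toL1 w‖ := by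
  rw [toL1_F_sub_eq, toL1_F_sub_eq, ← toL1_sub, ← toL1_sub]
  simp only [norm_toL1]
  exact norm_residual_sub_le p (le_max_right _ _) (le_max_left _ _)

theorem tendsto_toL1_comap (Φ : L1) :
    Filter.Tendsto toL1 (Filter.comap toL1 (𝓝 Φ)) (𝓝 Φ) := Filter.tendsto_comap

theorem continuous_h_max : Continuous fun q : L1 × L1 => h (max ‖q.1‖ ‖q.2‖) :=
  continuous_h.comp (by fun_prop)

/-- `F` is Lipschitz on balls, so that it has limits at the points of `ℓ¹`. -/
theorem tendsto_toL1_F (p : Parity) (Φ : L1) :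
    Filter.Tendsto (fun v => toL1 (F p v)) (Filter.comap toL1 (𝓝 Φ)) (𝓝 (Fbar p Φ)) := by
  refine tendsto_nhds_limUnder (cauchy_map_iff_exists_tendsto.1
    (cauchy_map_iff.2 ⟨inferInstance, tendsto_uniformity_iff_dist_tendsto_zero.2 ?_⟩))
  have hlim : Filter.Tendsto (fun q : L1 × L1 => (2 + h (max ‖q.1‖ ‖q.2‖)) * ‖q.1 - q.2‖)
      (𝓝 Φ ×ˢ 𝓝 Φ) (𝓝 0) := by
    have hc : Continuous fun q : L1 × L1 => (2 + h (max ‖q.1‖ ‖q.2‖)) * ‖q.1 - q.2‖ :=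
      (continuous_const.add continuous_h_max).mul (by fun_prop)
    simpa [nhds_prod_eq] using hc.tendsto (Φ, Φ)
  refine squeeze_zero (fun _ => dist_nonneg) (fun q => ?_)
    (hlim.comp ((tendsto_toL1_comap Φ).prodMap (tendsto_toL1_comap Φ)))
  have h1 := norm_toL1_F_sub_le p q.1 q.2
  have h2 : toL1 (F p q.1) - toL1 (F p q.2) =
      (toL1 (F p q.1) - (2 : ℝ) • toL1 q.1 - (toL1 (F p q.2) - (2 : ℝ) • toL1 q.2)) +
        (2 : ℝ) • (toL1 q.1 - toL1 q.2) := by module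
  rw [dist_eq_norm, h2]
  refine (norm_add_le _ _).trans ?_
  rw [norm_smul, Real.norm_of_nonneg zero_le_two]
  simp only [Function.comp_apply, Prod.map_fst, Prod.map_snd]
  linarith

theorem Fbar_toL1 (p : Parity) (Φ : ℕ →₀ ℝ) : Fbar p (toL1 Φ) = toL1 (F p Φ) := by
  -- the points `v = Φ` alone already determine the limit
  have hle : pure Φ ≤ Filter.comap toL1 (𝓝 (toL1 Φ)) :=
    Filter.map_le_iff_le_comap.1 (by rw [Filter.map_pure]; exact pure_le_nhds _)
  exact tendsto_nhds_unique ((tendsto_toL1_F p (toL1 Φ)).mono_left hle) (tendsto_pure_nhds _ Φ)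

theorem norm_Fbar_sub_le (p : Parity) (Φ Φ' : L1) :
    ‖(Fbar p Φ - (2 : ℝ) • Φ) - (Fbar p Φ' - (2 : ℝ) • Φ')‖ ≤
      h (max ‖Φ‖ ‖Φ'‖) * ‖Φ - Φ'‖ := by
  have t1 := (tendsto_toL1_F p Φ).sub ((tendsto_toL1_comap Φ).const_smul (2 : ℝ))
  have t2 := (tendsto_toL1_F p Φ').sub ((tendsto_toL1_comap Φ').const_smul (2 : ℝ))
  have hc : Continuous fun q : L1 × L1 => h (max ‖q.1‖ ‖q.2‖) * ‖q.1 - q.2‖ :=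
    continuous_h_max.mul (by fun_prop)
  have hlim := hc.tendsto (Φ, Φ')
  rw [nhds_prod_eq] at hlim
  exact le_of_tendsto_of_tendsto'
    ((t1.comp Filter.tendsto_fst).sub (t2.comp Filter.tendsto_snd)).norm
    (hlim.comp ((tendsto_toL1_comap Φ).prodMap (tendsto_toL1_comap Φ')))
    fun q => norm_toL1_F_sub_le p q.1 q.2

theorem norm_Fbar_sub_two_smul_le (p : Parity) (Φ : L1) :
    ‖Fbar p Φ - (2 : ℝ) • Φ‖ ≤ Real.sinh (2 * ‖Φ‖) - 2 * ‖Φ‖ := by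
  have hc : Continuous fun Φ : L1 => Real.sinh (2 * ‖Φ‖) - 2 * ‖Φ‖ := by fun_prop
  refine le_of_tendsto_of_tendsto'
    ((tendsto_toL1_F p Φ).sub ((tendsto_toL1_comap Φ).const_smul (2 : ℝ))).norm
    ((hc.tendsto Φ).comp (tendsto_toL1_comap Φ)) fun v => ?_
  rw [toL1_F_sub_eq, Function.comp_apply, norm_toL1, norm_toL1]
  exact norm_residual_le p v

/-- On the ball of radius `R`, the map `F̄` is a perturbation of `2 · id` with Lipschitz constant
`h R`. -/
theorem Fbar_bounds (p : Parity) {Φ Φ' : L1} {R : ℝ} (hΦ : ‖Φ‖ ≤ R) (hΦ' : ‖Φ'‖ ≤ R) :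
    (2 - h R) * ‖Φ - Φ'‖ ≤ ‖Fbar p Φ - Fbar p Φ'‖ ∧
      ‖Fbar p Φ - Fbar p Φ'‖ ≤ (2 + h R) * ‖Φ - Φ'‖ := by
  have h1 := (norm_Fbar_sub_le p Φ Φ').trans (mul_le_mul_of_nonneg_right
    (h_le_h ((norm_nonneg _).trans (le_max_left _ _)) (max_le hΦ hΦ')) (norm_nonneg _))
  have h2 : ‖(2 : ℝ) • (Φ - Φ')‖ = 2 * ‖Φ - Φ'‖ := by
    rw [norm_smul, Real.norm_of_nonneg zero_le_two]
  have h4 := norm_add_le (Fbar p Φ - (2 : ℝ) • Φ - (Fbar p Φ' - (2 : ℝ) • Φ'))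
    ((2 : ℝ) • (Φ - Φ'))
  have h5 := norm_sub_le ((2 : ℝ) • (Φ - Φ') +
    (Fbar p Φ - (2 : ℝ) • Φ - (Fbar p Φ' - (2 : ℝ) • Φ')))
    (Fbar p Φ - (2 : ℝ) • Φ - (Fbar p Φ' - (2 : ℝ) • Φ'))
  rw [add_sub_cancel_right] at h5
  rw [show (2 : ℝ) • (Φ - Φ') + (Fbar p Φ - (2 : ℝ) • Φ - (Fbar p Φ' - (2 : ℝ) • Φ')) =
    Fbar p Φ - Fbar p Φ' by module] at h5
  rw [show Fbar p Φ - (2 : ℝ) • Φ - (Fbar p Φ' - (2 : ℝ) • Φ') + (2 : ℝ) • (Φ - Φ') =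
    Fbar p Φ - Fbar p Φ' by module] at h4
  constructor <;> linarith

theorem continuous_Fbar (p : Parity) : Continuous (Fbar p) := by
  refine continuous_iff_continuousAt.2 fun Φ => tendsto_iff_norm_sub_tendsto_zero.2 ?_
  have hc : Continuous fun Φ' : L1 => (2 + h (max ‖Φ'‖ ‖Φ‖)) * ‖Φ' - Φ‖ :=
    (continuous_const.add (continuous_h.comp (by fun_prop))).mul (by fun_prop)
  refine squeeze_zero (fun _ => norm_nonneg _)
    (fun Φ' => (Fbar_bounds p (le_max_left _ _) (le_max_right _ _)).2) ?_
  simpa using hc.tendsto Φ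

/-! ### Inversion -/

theorem HInv_lt_rPhi {θ : ℝ} (h0 : 0 ≤ θ) (h1 : θ < rC) : HInv θ < rPhi := by
  obtain ⟨hm, hH⟩ := HInv_spec h0 h1.le
  refine lt_of_le_of_ne hm.2 fun he => ?_
  rw [he] at hH
  exact h1.ne' hH

theorem lowerConst_pos {θ : ℝ} (h0 : 0 ≤ θ) (h1 : θ < rC) : 0 < lowerConst θ := by
  have := h_lt_h (HInv_spec h0 h1.le).1.1 (HInv_lt_rPhi h0 h1)
  rw [rPhi_spec.2] at this
  exact sub_pos.2 this

/-- The equation `F̄(Φ) = c` says that `Φ` is a fixed point of `Φ ↦ (c - (F̄(Φ) - 2 Φ)) / 2`. This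
map is a contraction of the ball of radius `R = H⁻¹(θ)`, because `H R = θ` is the same as
`(θ + (sinh (2 R) - 2 R)) / 2 = R`. -/
theorem exists_Fbar_eq (p : Parity) {θ : ℝ} {c : L1} (hc : ‖c‖ ≤ θ) (hθ : θ < rC) :
    ∃ Φ : L1, ‖Φ‖ ≤ HInv θ ∧ Fbar p Φ = c := by
  have h0 : 0 ≤ θ := (norm_nonneg c).trans hc
  obtain ⟨⟨hR0, -⟩, hH⟩ := HInv_spec h0 hθ.le
  have hpos : 0 < 2 - h (HInv θ) := lowerConst_pos h0 hθ
  set R := HInv θ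
  let T : L1 → L1 := fun Φ => (1 / 2 : ℝ) • (c - (Fbar p Φ - (2 : ℝ) • Φ))
  have hmaps : Set.MapsTo T (Metric.closedBall 0 R) (Metric.closedBall 0 R) := by
    intro Φ hΦ
    rw [mem_closedBall_zero_iff] at hΦ ⊢
    have h1 := norm_Fbar_sub_two_smul_le p Φ
    have h2 : Real.sinh (2 * ‖Φ‖) - 2 * ‖Φ‖ ≤ Real.sinh (2 * R) - 2 * R :=
      Real.sinh_sub_id_strictMono.monotone (by linarith)
    have h3 := norm_sub_le c (Fbar p Φ - (2 : ℝ) • Φ)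
    rw [norm_smul, Real.norm_of_nonneg (by norm_num)]
    unfold H at hH
    linarith
  have hcontr : ContractingWith (h R / 2).toNNReal
      (hmaps.restrict T _ _) := by
    refine ⟨?_, LipschitzWith.of_dist_le_mul fun Φ Φ' => ?_⟩
    · rw [Real.toNNReal_lt_one]
      linarith
    · have hΦ := mem_closedBall_zero_iff.1 Φ.2
      have hΦ' := mem_closedBall_zero_iff.1 Φ'.2
      have h1 := (norm_Fbar_sub_le p Φ' Φ).trans (mul_le_mul_of_nonneg_right
        (h_le_h ((norm_nonneg _).trans (le_max_left _ _)) (max_le hΦ' hΦ)) (norm_nonneg _))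
      rw [Subtype.dist_eq, Subtype.dist_eq, Set.MapsTo.val_restrict_apply,
        Set.MapsTo.val_restrict_apply, dist_eq_norm, dist_eq_norm,
        Real.coe_toNNReal _ (div_nonneg (h_nonneg R) zero_le_two)]
      rw [show T Φ - T Φ' = (1 / 2 : ℝ) • ((Fbar p Φ' - (2 : ℝ) • (Φ' : L1)) -
        (Fbar p Φ - (2 : ℝ) • (Φ : L1))) by simp only [T]; module, norm_smul,
        Real.norm_of_nonneg (by norm_num), norm_sub_rev (Φ : L1)]
      linarith
  obtain ⟨Φ, hΦ, hfix, -⟩ := hcontr.exists_fixedPoint' Metric.isClosed_closedBall.isComplete hmaps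
    (Metric.mem_closedBall_self hR0) (edist_ne_top _ _)
  refine ⟨Φ, mem_closedBall_zero_iff.1 hΦ, ?_⟩
  have h1 : (2 : ℝ) • T Φ = (2 : ℝ) • Φ := by rw [hfix.eq]
  have h2 : (2 : ℝ) • T Φ = c - Fbar p Φ + (2 : ℝ) • Φ := by simp only [T]; module
  rw [h2, add_eq_right, sub_eq_zero] at h1
  exact h1.symm

theorem Fbar_injOn (p : Parity) : Set.InjOn (Fbar p) (Metric.ball 0 rPhi) := by
  intro Φ hΦ Φ' hΦ' he
  rw [mem_ball_zero_iff] at hΦ hΦ'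
  have h1 := (Fbar_bounds p (le_max_left ‖Φ‖ ‖Φ'‖) (le_max_right ‖Φ‖ ‖Φ'‖)).1
  have h2 := h_lt_h ((norm_nonneg Φ).trans (le_max_left _ _)) (max_lt hΦ hΦ')
  rw [rPhi_spec.2] at h2
  rw [he, sub_self, norm_zero] at h1
  have h3 := nonpos_of_mul_nonpos_right h1 (by linarith)
  exact sub_eq_zero.1 (norm_le_zero_iff.1 h3)

theorem FbarInv_spec (p : Parity) {θ : ℝ} {c : L1} (hc : ‖c‖ ≤ θ) (hθ : θ < rC) :
    ‖FbarInv p c‖ ≤ HInv θ ∧ ‖FbarInv p c‖ < rPhi ∧ Fbar p (FbarInv p c) = c := by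
  obtain ⟨Φ, hΦ, he⟩ := exists_Fbar_eq p hc hθ
  have hΦ' : Φ ∈ Metric.ball (0 : L1) rPhi :=
    mem_ball_zero_iff.2 (hΦ.trans_lt (HInv_lt_rPhi ((norm_nonneg c).trans hc) hθ))
  have hex : ∃ Φ ∈ Metric.ball (0 : L1) rPhi, Fbar p Φ = c := ⟨Φ, hΦ', he⟩
  have h1 : FbarInv p c ∈ Metric.ball (0 : L1) rPhi := Function.invFunOn_mem hex
  have h2 : Fbar p (FbarInv p c) = c := Function.invFunOn_eq hex
  have h3 : FbarInv p c = Φ := Fbar_injOn p h1 hΦ' (h2.trans he.symm)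
  exact ⟨h3 ▸ hΦ, mem_ball_zero_iff.1 h1, h2⟩

end IQSP

end

theorem mainTheorem2 (p : IQSP.Parity) :
    -- the map `F` gives the Chebyshev coefficients of `g(·, Φ)`
    (∀ (Φ : ℕ →₀ ℝ) (x : ℝ), x ∈ Set.Icc (-1 : ℝ) 1 →
      IQSP.g p x Φ = IQSP.chebSum p (IQSP.F p Φ) x) ∧
    -- `F̄` is the continuous extension of `F` to `ℓ¹`
    (Continuous (IQSP.Fbar p) ∧
      ∀ Φ : ℕ →₀ ℝ, IQSP.Fbar p (IQSP.toL1 Φ) = IQSP.toL1 (IQSP.F p Φ)) ∧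
    -- `F̄⁻¹` inverts `F̄` on the ball of radius `r_c`
    (∀ c : IQSP.L1, ‖c‖ < IQSP.rC →
      ‖IQSP.FbarInv p c‖ < IQSP.rPhi ∧ IQSP.Fbar p (IQSP.FbarInv p c) = c ∧
      ∀ Φ : IQSP.L1, ‖Φ‖ < IQSP.rPhi → IQSP.Fbar p Φ = c → Φ = IQSP.FbarInv p c) ∧
    -- equivalence of distance
    (∀ (θ : ℝ) (c₁ c₂ : IQSP.L1), θ < IQSP.rC → ‖c₁‖ ≤ θ → ‖c₂‖ ≤ θ →
      0 < IQSP.lowerConst θ ∧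
      IQSP.lowerConst θ * ‖IQSP.FbarInv p c₁ - IQSP.FbarInv p c₂‖ ≤ ‖c₁ - c₂‖ ∧
      ‖c₁ - c₂‖ ≤ IQSP.upperConst θ * ‖IQSP.FbarInv p c₁ - IQSP.FbarInv p c₂‖) ∧
    -- `F̄` is bi-Lipschitz near the origin
    (∃ r > 0, ∃ a > 0, ∃ b > 0, ∀ Φ₁ Φ₂ : IQSP.L1, ‖Φ₁‖ < r → ‖Φ₂‖ < r →
      a * ‖Φ₁ - Φ₂‖ ≤ ‖IQSP.Fbar p Φ₁ - IQSP.Fbar p Φ₂‖ ∧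
      ‖IQSP.Fbar p Φ₁ - IQSP.Fbar p Φ₂‖ ≤ b * ‖Φ₁ - Φ₂‖) := by
  refine ⟨fun Φ x hx => ?_, ⟨IQSP.continuous_Fbar p, IQSP.Fbar_toL1 p⟩, fun c hc => ?_,
    fun θ c₁ c₂ hθ h₁ h₂ => ?_, ?_⟩
  · rw [IQSP.F_eq_coeffs, IQSP.g_eq_chebSum p Φ hx]
  · obtain ⟨-, hlt, he⟩ := IQSP.FbarInv_spec p le_rfl hc
    exact ⟨hlt, he, fun Φ hΦ hΦc => IQSP.Fbar_injOn p (mem_ball_zero_iff.2 hΦ)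
      (mem_ball_zero_iff.2 hlt) (hΦc.trans he.symm)⟩
  · obtain ⟨n₁, -, e₁⟩ := IQSP.FbarInv_spec p h₁ hθ
    obtain ⟨n₂, -, e₂⟩ := IQSP.FbarInv_spec p h₂ hθ
    have hb := IQSP.Fbar_bounds p n₁ n₂
    rw [e₁, e₂] at hb
    have hu : IQSP.upperConst θ = 2 + IQSP.h (IQSP.HInv θ) := by
      unfold IQSP.upperConst IQSP.C₁ IQSP.h
      ring
    rw [hu]
    exact ⟨IQSP.lowerConst_pos ((norm_nonneg c₁).trans h₁) hθ, hb⟩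
  · have h0 : 0 < IQSP.rPhi := by
      refine lt_of_le_of_ne IQSP.rPhi_spec.1 fun he => ?_
      have := IQSP.rPhi_spec.2
      rw [← he] at this
      simp [IQSP.h] at this
    have h1 := IQSP.h_lt_h (by positivity : 0 ≤ IQSP.rPhi / 2) (half_lt_self h0)
    rw [IQSP.rPhi_spec.2] at h1
    exact ⟨IQSP.rPhi / 2, half_pos h0, _, sub_pos.2 h1, _,
      add_pos_of_pos_of_nonneg two_pos (IQSP.h_nonneg _),
      fun Φ₁ Φ₂ h₁ h₂ => IQSP.Fbar_bounds p h₁.le h₂.le⟩
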